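/- Let $\mathcal G=(\mathcal V,\mathcal E,\mathcal A)$ be a weighted directed graph on $n$ nodes with weights $a_{ij}\ge 0$, $a_{ii}=0$, where $a_{ij}>0$ if and only if $(j,i)\in\mathcal E$, and let $\mathcal N_i=\{j:(j,i)\in\mathcal E\}$. Assume that $\mathcal G$ has a directed spanning tree. Let $C\in\mathbb R^{d\times d}$ be a matrix with nonnegative diagonal entries such that $1$ is an eigenvalue of $C$ which is semi-simple (its algebraic and geometric multiplicities are equal), and such that every other complex eigenvalue of $C$ has real part less than $1$. Then there is $\alpha_0>0$ such that for every $\alpha\in(0,\alpha_0)$ the graph $\overline{\mathcal G}=(\mathcal V,\mathcal E,\alpha\mathcal A)$, which has the same nodes and edges and the weights $\bar a_{ij}=\alpha a_{ij}$, achieves consensus: every solution on $[0,\infty)$ of $$\dot x_i(t)=\sum_{j\in\mathcal N_i}\bar a_{ij}\,C\,(x_j(t)-x_i(t))+(C-I_d)\,x_i(t),\qquad x_i(t)\in\mathbb R^d,\quad i=1,\dots,n,$$ satisfies $\lim_{t\to\infty}\|x_i(t)-x_j(t)\|=0$ for all $i,j$. -/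

import Mathlib

open Filter Topology

noncomputable section

/-- A weighted directed graph on the nodes `Fin n`. An edge `(j, i)` goes from `j` to `i` and means
that `i` takes the opinion of `j` into account; its weight is the entry `weight i j`. -/
structure WeightedDigraph (n : ℕ) where
  edges : Set (Fin n × Fin n)
  weight : Matrix (Fin n) (Fin n) ℝ
  weight_nonneg : ∀ i j, 0 ≤ weight i j
  weight_pos_iff : ∀ i j, 0 < weight i j ↔ (j, i) ∈ edges
  weight_self : ∀ i, weight i i = 0

namespace WeightedDigraph

variable {n : ℕ}

open Classical in
/-- The set of incoming neighbours of the node `i`. -/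
def neighbors (G : WeightedDigraph n) (i : Fin n) : Finset (Fin n) :=
  Finset.univ.filter fun j => (j, i) ∈ G.edges

/-- Some subset `T` of the edges is a directed spanning tree: there is a root `r` without a parent,
every other node has exactly one parent, and every node is reachable from `r` along `T`. -/
def HasDirectedSpanningTree (G : WeightedDigraph n) : Prop :=
  ∃ T : Set (Fin n × Fin n), T ⊆ G.edges ∧ ∃ r : Fin n,
    (∀ u, (u, r) ∉ T) ∧
    (∀ v, v ≠ r → ∃! u, (u, v) ∈ T) ∧
    (∀ v, Relation.ReflTransGen (fun u w => (u, w) ∈ T) r v)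

end WeightedDigraph

/-- The complex matrix with the same entries as the real matrix `C`. -/
def complexify {d : ℕ} (C : Matrix (Fin d) (Fin d) ℝ) : Matrix (Fin d) (Fin d) ℂ :=
  C.map Complex.ofReal

/-- The standing assumption on a logic matrix: `1` is an eigenvalue, it is semi-simple (its geometric
and its algebraic multiplicity agree), every other complex eigenvalue has real part less than `1`,
and the diagonal entries are nonnegative. -/
structure IsLogicMatrix {d : ℕ} (C : Matrix (Fin d) (Fin d) ℝ) : Prop where
  one_eigenvalue : Module.End.HasEigenvalue (Matrix.toLin' (complexify C)) 1
  one_semisimple :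
    Module.finrank ℂ (Module.End.eigenspace (Matrix.toLin' (complexify C)) 1) =
      (complexify C).charpoly.rootMultiplicity 1
  re_lt_one : ∀ z : ℂ, Module.End.HasEigenvalue (Matrix.toLin' (complexify C)) z →
    z ≠ 1 → z.re < 1
  diag_nonneg : ∀ i, 0 ≤ C i i

/-- `x` solves, on `[0, ∞)`, the dynamics of Model 1 without stubbornness:
`ẋ_i = ∑_{j ∈ N_i} a_ij C (x_j - x_i) + (C - I) x_i` for every individual `i`. -/
def IsModelOneTrajectory {n d : ℕ} (G : WeightedDigraph n) (C : Matrix (Fin d) (Fin d) ℝ)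
    (x : ℝ → Fin n → EuclideanSpace ℝ (Fin d)) : Prop :=
  ∀ t : ℝ, 0 ≤ t → ∀ i : Fin n,
    HasDerivWithinAt (fun s => x s i)
      ((∑ j ∈ G.neighbors i, G.weight i j • Matrix.toEuclideanLin C (x t j - x t i))
        + Matrix.toEuclideanLin (C - 1) (x t i))
      (Set.Ici 0) t

/-- Consensus of opinions is achieved under Model 1 without stubbornness: for every solution,
whatever the initial opinions, all differences of opinions tend to zero. -/
def AchievesConsensus {n d : ℕ} (G : WeightedDigraph n) (C : Matrix (Fin d) (Fin d) ℝ) : Prop :=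
  ∀ x : ℝ → Fin n → EuclideanSpace ℝ (Fin d), IsModelOneTrajectory G C x →
    ∀ i j : Fin n, Tendsto (fun t => ‖x t i - x t j‖) atTop (𝓝 0)

end

/-!
Write the state as an `n × d` matrix `X` and let `L` be the Laplacian of the graph. The dynamics is
`Ẋ = (X - L X) Cᵀ - X`, and the proof follows the linear functionals of the state along a solution.
The functional with coefficient matrix `Φ` has as derivative the functional with coefficient matrix
`F Φ = (Φ - Lᵀ Φ) C - Φ`. Since the rows of `L` sum to zero, `F` preserves the space of matrices
whose columns sum to zero. These are the functionals that vanish on consensus states, and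
consensus means that all of them tend to zero along every solution.

This holds as soon as the eigenvalues of `F` on that space have negative real part
(`tendsto_zero_of_eigenvalues_re_neg`): the space is spanned by generalized eigenvectors, and a
chain of these gives scalar equations `f' = μ f + g` with `g → 0`. The operators `Φ ↦ Lᵀ Φ` and
`Φ ↦ Φ C` commute, so a common eigenvector shows that an eigenvalue of `F` has the form
`(1 - z) μ - 1`, with `μ` an eigenvalue of `C` and `z` an eigenvalue of `Lᵀ` on vectors with sum
zero (`WeightedDigraph.achievesConsensus_of_re_lt_one`).

If there is a spanning tree, then `0 < z.re`
(`WeightedDigraph.re_pos_of_mem_disagreementSpectrum`). Scaling the weights by `α` replaces `z` by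
`α z`. For `μ = 1` the value `(1 - α z) μ - 1 = -α z` has negative real part for every `α > 0`; for
`μ ≠ 1` it tends to `μ - 1` as `α → 0`, whose real part is negative. There are finitely many pairs
`(z, μ)`, so one bound on `α` serves them all.
-/

open Module End Matrix

/-! ### Asymptotics of linear differential equations -/

/-- A Gronwall estimate for `‖f‖²`: by Young's inequality its derivative is at most
`μ.re * ‖f‖² + ‖g‖² / (-μ.re)`. -/
theorem tendsto_zero_of_hasDerivWithinAt_mul_add {μ : ℂ} (hμ : μ.re < 0) {f g : ℝ → ℂ}
    (hf : ∀ t : ℝ, 0 ≤ t → HasDerivWithinAt f (μ * f t + g t) (Set.Ici 0) t)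
    (hg : Tendsto g atTop (𝓝 0)) : Tendsto f atTop (𝓝 0) := by
  set a : ℝ := -μ.re with ha
  have ha0 : 0 < a := by linarith
  have hu (t : ℝ) (ht : 0 ≤ t) : HasDerivWithinAt (fun s => ‖f s‖ ^ 2)
      (2 * inner ℝ (f t) (μ * f t + g t)) (Set.Ici 0) t := (hf t ht).norm_sq
  have hbound (t : ℝ) :
      2 * inner ℝ (f t) (μ * f t + g t) ≤ -a * ‖f t‖ ^ 2 + ‖g t‖ ^ 2 / a := by
    have h1 : inner ℝ (f t) (μ * f t) = -a * ‖f t‖ ^ 2 := by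
      rw [Complex.inner, Complex.sq_norm, Complex.normSq_apply]
      simp [ha]
      ring
    have h2 : inner ℝ (f t) (g t) ≤ ‖f t‖ * ‖g t‖ := real_inner_le_norm _ _
    have h3 : 2 * (‖f t‖ * ‖g t‖) ≤ a * ‖f t‖ ^ 2 + ‖g t‖ ^ 2 / a := by
      have : 0 ≤ (a * ‖f t‖ - ‖g t‖) ^ 2 / a := by positivity
      have e : (a * ‖f t‖ - ‖g t‖) ^ 2 / a
          = a * ‖f t‖ ^ 2 + ‖g t‖ ^ 2 / a - 2 * (‖f t‖ * ‖g t‖) := by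
        field_simp
        ring
      linarith
    rw [inner_add_right, h1]
    linarith
  rw [tendsto_zero_iff_norm_tendsto_zero]
  have hsq : Tendsto (fun t => ‖f t‖ ^ 2) atTop (𝓝 0) := by
    refine tendsto_order.2 ⟨fun b hb => Eventually.of_forall fun t => hb.trans_le (sq_nonneg _), ?_⟩
    intro ε hε
    -- With `‖g‖² ≤ a² ε / 2` the equilibrium level of the Gronwall bound is `ε / 2`.
    have hgε : ∀ᶠ t in atTop, ‖g t‖ ^ 2 < a ^ 2 * (ε / 2) := by
      have : Tendsto (fun t => ‖g t‖ ^ 2) atTop (𝓝 0) := by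
        simpa using (tendsto_zero_iff_norm_tendsto_zero.1 hg).pow 2
      exact this.eventually_lt_const (by positivity)
    obtain ⟨T, hT⟩ := eventually_atTop.1 (hgε.and (eventually_ge_atTop 0))
    have hT0 : 0 ≤ T := (hT T le_rfl).2
    have key (t : ℝ) (ht : T ≤ t) :
        ‖f t‖ ^ 2 ≤ gronwallBound (‖f T‖ ^ 2) (-a) (a * (ε / 2)) (t - T) := by
      refine le_gronwallBound_of_liminf_deriv_right_le (f := fun s => ‖f s‖ ^ 2)
        (f' := fun s => 2 * inner ℝ (f s) (μ * f s + g s)) (a := T) (b := t)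
        ?_ ?_ le_rfl ?_ t ⟨ht, le_rfl⟩
      · intro s hs
        exact ((hu s (hT0.trans hs.1)).mono fun y hy => hT0.trans hy.1).continuousWithinAt
      · intro s hs r hr
        exact ((hu s (hT0.trans hs.1)).mono
          fun y hy => (hT0.trans hs.1).trans hy).liminf_right_slope_le hr
      · intro s hs
        refine (hbound s).trans ?_
        have := (hT s hs.1).1
        have : ‖g s‖ ^ 2 / a ≤ a * (ε / 2) := by
          rw [div_le_iff₀ ha0]
          linarith
        linarith
    have hlim : Tendsto (fun t => Real.exp (-a * (t - T))) atTop (𝓝 0) := by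
      refine Real.tendsto_exp_atBot.comp ?_
      exact (tendsto_atTop_add_const_right _ _ tendsto_id).const_mul_atTop_of_neg (by linarith)
    have hlim2 : Tendsto (fun t => gronwallBound (‖f T‖ ^ 2) (-a) (a * (ε / 2)) (t - T))
        atTop (𝓝 (ε / 2)) := by
      rw [gronwallBound_of_K_ne_0 (neg_ne_zero.2 ha0.ne')]
      have := (hlim.const_mul (‖f T‖ ^ 2)).add ((hlim.sub_const 1).const_mul (a * (ε / 2) / -a))
      convert this using 2
      field_simp
      ring
    filter_upwards [hlim2.eventually_lt_const (by linarith : ε / 2 < ε), eventually_ge_atTop T]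
      with t h1 h2
    exact (key t h2).trans_lt h1
  simpa using hsq.sqrt

/-- If `t ↦ ℓ t v` has derivative `ℓ t (F v)` and the eigenvalues of `F` on the invariant subspace
`W` lie in the open left half-plane, then `ℓ t` tends to zero on `W`. The generalized eigenvectors
of `F` span `W`, and on a chain of generalized eigenvectors each function is driven by the
previous one. -/
theorem tendsto_zero_of_eigenvalues_re_neg {V : Type*} [AddCommGroup V] [Module ℂ V]
    [FiniteDimensional ℂ V] (F : End ℂ V) (W : Submodule ℂ V) (hW : ∀ v ∈ W, F v ∈ W)
    (hF : ∀ ν : ℂ, ∀ v ∈ W, v ≠ 0 → F v = ν • v → ν.re < 0) (ℓ : ℝ → V →ₗ[ℂ] ℂ)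
    (hℓ : ∀ v, ∀ t : ℝ, 0 ≤ t → HasDerivWithinAt (fun s => ℓ s v) (ℓ t (F v)) (Set.Ici 0) t)
    {v : V} (hv : v ∈ W) : Tendsto (fun t => ℓ t v) atTop (𝓝 0) := by
  let S : Submodule ℂ W :=
    { carrier := {w | Tendsto (fun t => ℓ t w) atTop (𝓝 0)}
      add_mem' := fun {x y} hx hy => by simpa using Tendsto.add hx hy
      zero_mem' := by simp
      smul_mem' := fun c x hx => by simpa using Tendsto.const_mul c hx }
  let f : End ℂ W := F.restrict hW
  suffices h : (⊤ : Submodule ℂ W) ≤ S from h (x := ⟨v, hv⟩) trivial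
  rw [← iSup_maxGenEigenspace_eq_top f]
  refine iSup_le fun ν w hw => ?_
  rcases eq_or_ne w 0 with rfl | hw0
  · exact S.zero_mem
  have hν : ν.re < 0 := by
    have hev : f.HasEigenvalue ν := by
      rw [mem_maxGenEigenspace] at hw
      obtain ⟨k, hk⟩ := hw
      refine hasEigenvalue_of_hasGenEigenvalue (k := k) ?_
      rw [HasGenEigenvalue, HasUnifEigenvalue, Submodule.ne_bot_iff]
      exact ⟨w, mem_genEigenspace_nat.2 hk, hw0⟩
    obtain ⟨x, hx⟩ := hev.exists_hasEigenvector
    refine hF ν x x.2 (by simpa using hx.2) ?_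
    simpa [f] using congrArg Subtype.val hx.apply_eq_smul
  rw [mem_maxGenEigenspace] at hw
  obtain ⟨k, hk⟩ := hw
  clear hw0
  induction k generalizing w with
  | zero =>
    obtain rfl : w = 0 := by simpa using hk
    exact S.zero_mem
  | succ k ih =>
    have hS : (f - ν • (1 : End ℂ W)) w ∈ S := ih _ (by rwa [pow_succ] at hk)
    refine tendsto_zero_of_hasDerivWithinAt_mul_add hν (fun t ht => ?_) hS
    convert hℓ w t ht using 1
    simp [f]

/-! ### Commuting operators -/

theorem exists_eigenvector_mem_of_invariant {V : Type*} [AddCommGroup V] [Module ℂ V]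
    [FiniteDimensional ℂ V] (f : End ℂ V) (p : Submodule ℂ V) (hp : ∀ v ∈ p, f v ∈ p)
    (hne : ∃ v ∈ p, v ≠ 0) : ∃ v ∈ p, v ≠ 0 ∧ ∃ μ : ℂ, f v = μ • v := by
  have : Nontrivial p := (Submodule.nontrivial_iff_ne_bot).2 ((Submodule.ne_bot_iff p).2 hne)
  obtain ⟨μ, hμ⟩ := exists_eigenvalue (f.restrict hp)
  obtain ⟨x, hx⟩ := hμ.exists_hasEigenvector
  exact ⟨x, x.2, by simpa using hx.2, μ, by simpa using congrArg Subtype.val hx.apply_eq_smul⟩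

/-- Commuting operators `A` and `B` have a common eigenvector inside each eigenspace of an
operator commuting with both. -/
theorem exists_common_eigenvector {V : Type*} [AddCommGroup V] [Module ℂ V]
    [FiniteDimensional ℂ V] {A B F : End ℂ V} (W : Submodule ℂ V)
    (hA : ∀ v ∈ W, A v ∈ W) (hB : ∀ v ∈ W, B v ∈ W) (hAB : Commute A B) (hAF : Commute A F)
    (hBF : Commute B F) {ν : ℂ} (hν : ∃ v ∈ W, v ≠ 0 ∧ F v = ν • v) :
    ∃ v ∈ W, v ≠ 0 ∧ F v = ν • v ∧ (∃ a : ℂ, A v = a • v) ∧ ∃ b : ℂ, B v = b • v := by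
  have hAF' (v : V) : F (A v) = A (F v) := (LinearMap.congr_fun hAF.eq v).symm
  have hBF' (v : V) : F (B v) = B (F v) := (LinearMap.congr_fun hBF.eq v).symm
  have hAB' (v : V) : A (B v) = B (A v) := LinearMap.congr_fun hAB.eq v
  obtain ⟨v, hv, hv0, hFv⟩ := hν
  obtain ⟨w, ⟨hwW, hwF⟩, hw0, a, hwa⟩ := exists_eigenvector_mem_of_invariant A
    (W ⊓ F.eigenspace ν) (fun v hv => ⟨hA v hv.1, by
      have := mem_eigenspace_iff.1 hv.2
      exact mem_eigenspace_iff.2 (by rw [hAF', this, map_smul])⟩)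
    ⟨v, ⟨hv, mem_eigenspace_iff.2 hFv⟩, hv0⟩
  obtain ⟨u, ⟨⟨huW, huF⟩, hua⟩, hu0, b, hub⟩ := exists_eigenvector_mem_of_invariant B
    (W ⊓ F.eigenspace ν ⊓ A.eigenspace a) (fun v hv => ⟨⟨hB v hv.1.1, by
      have := mem_eigenspace_iff.1 hv.1.2
      exact mem_eigenspace_iff.2 (by rw [hBF', this, map_smul])⟩, by
      have := mem_eigenspace_iff.1 hv.2
      exact mem_eigenspace_iff.2 (by rw [hAB', this, map_smul])⟩)
    ⟨w, ⟨⟨hwW, hwF⟩, mem_eigenspace_iff.2 hwa⟩, hw0⟩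
  exact ⟨u, huW, hu0, mem_eigenspace_iff.1 huF, ⟨a, mem_eigenspace_iff.1 hua⟩, b, hub⟩

/-! ### The Laplacian of a weighted directed graph -/

namespace WeightedDigraph

variable {n : ℕ} (G : WeightedDigraph n)

/-- The in-degree Laplacian, with rows summing to zero. -/
def laplacian : Matrix (Fin n) (Fin n) ℝ :=
  diagonal (fun i => ∑ j, G.weight i j) - G.weight

theorem laplacian_mulVec (v : Fin n → ℝ) (i : Fin n) :
    (G.laplacian *ᵥ v) i = ∑ j, G.weight i j * (v i - v j) := by
  rw [laplacian, sub_mulVec, Pi.sub_apply, mulVec_diagonal]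
  simp [mul_sub, Finset.sum_mul, mulVec, dotProduct]

theorem sum_laplacian_row (i : Fin n) : ∑ j, G.laplacian i j = 0 := by
  simp [laplacian, diagonal_apply]

/-- A maximum principle: the nodes where `v` is maximal are closed under passing to parents, so
they contain the root of a spanning tree. -/
theorem le_root_of_laplacian_mulVec_nonpos {T : Set (Fin n × Fin n)} (hT : T ⊆ G.edges)
    {r : Fin n} (hr : ∀ v, Relation.ReflTransGen (fun u w => (u, w) ∈ T) r v) {v : Fin n → ℝ}
    (hv : ∀ i, (G.laplacian *ᵥ v) i ≤ 0) (i : Fin n) : v i ≤ v r := by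
  have : Nonempty (Fin n) := ⟨r⟩
  obtain ⟨m, hm⟩ := Finite.exists_max v
  suffices h : v r = v m from h ▸ hm i
  refine Relation.ReflTransGen.head_induction_on (motive := fun u _ => v u = v m) (hr m) rfl ?_
  intro a c hac _ hc
  have hnn (j : Fin n) : 0 ≤ G.weight c j * (v c - v j) :=
    mul_nonneg (G.weight_nonneg c j) (by rw [hc]; exact sub_nonneg.2 (hm j))
  have hsum : ∑ j, G.weight c j * (v c - v j) = 0 :=
    le_antisymm (G.laplacian_mulVec v c ▸ hv c) (Finset.sum_nonneg fun j _ => hnn j)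
  have h0 := (Finset.sum_eq_zero_iff_of_nonneg fun j _ => hnn j).1 hsum a (Finset.mem_univ a)
  have hpos : 0 < G.weight c a := (G.weight_pos_iff c a).2 (hT hac)
  rcases mul_eq_zero.1 h0 with h | h <;> linarith

/-- The eigenvalues of the transposed Laplacian on the invariant subspace of vectors with sum zero,
that is, the eigenvalues of the operator induced by the Laplacian on the quotient by the consensus
vectors. -/
def disagreementSpectrum : Set ℂ :=
  {z | ∃ p : Fin n → ℂ, p ≠ 0 ∧ ∑ i, p i = 0 ∧ p ᵥ* complexify G.laplacian = z • p}

theorem finite_disagreementSpectrum : G.disagreementSpectrum.Finite := by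
  refine (finite_hasEigenvalue (toLin' (complexify G.laplacian)ᵀ)).subset ?_
  rintro z ⟨p, hp0, -, hp⟩
  exact hasEigenvalue_of_hasEigenvector (x := p)
    ⟨mem_eigenspace_iff.2 (by rw [toLin'_apply, mulVec_transpose, hp]), hp0⟩

/-- Nonzero values are excluded from the closed left half-plane by Gershgorin's theorem. For the
value zero, adding to the Laplacian the matrix whose column at the root is constant equal to one
and whose other columns vanish gives a nonsingular matrix with the same action on vectors with sum
zero. -/
theorem re_pos_of_mem_disagreementSpectrum (hG : G.HasDirectedSpanningTree) {z : ℂ}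
    (hz : z ∈ G.disagreementSpectrum) : 0 < z.re := by
  obtain ⟨p, hp0, hsum, hp⟩ := hz
  by_contra hre
  push Not at hre
  refine hp0 ?_
  rcases eq_or_ne z 0 with rfl | hz0
  · obtain ⟨T, hT, r, -, -, hr⟩ := hG
    let M : Matrix (Fin n) (Fin n) ℝ := G.laplacian + vecMulVec 1 (Pi.single r 1)
    have hM : M.det ≠ 0 := by
      rw [Ne, ← exists_mulVec_eq_zero_iff]
      rintro ⟨v, hv0, hv⟩
      have hLv (i : Fin n) : (G.laplacian *ᵥ v) i = -v r := by
        have := congrFun hv i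
        rw [add_mulVec, vecMulVec_mulVec, Pi.add_apply] at this
        simp at this
        linarith
      have hLv' (i : Fin n) : (G.laplacian *ᵥ (-v)) i = v r := by
        rw [mulVec_neg, Pi.neg_apply, hLv, neg_neg]
      have hroot : v r = 0 := by
        rcases le_total 0 (v r) with h | h
        · have hle := G.le_root_of_laplacian_mulVec_nonpos hT hr (v := v)
            (fun i => by rw [hLv]; linarith)
          have := G.laplacian_mulVec v r ▸ hLv r
          have := Finset.sum_nonneg fun j (_ : j ∈ Finset.univ) =>
            mul_nonneg (G.weight_nonneg r j) (sub_nonneg.2 (hle j))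
          linarith
        · have hle := G.le_root_of_laplacian_mulVec_nonpos hT hr (v := -v)
            (fun i => by rw [hLv']; linarith)
          have := G.laplacian_mulVec (-v) r ▸ hLv' r
          have := Finset.sum_nonneg fun j (_ : j ∈ Finset.univ) =>
            mul_nonneg (G.weight_nonneg r j) (sub_nonneg.2 (hle j))
          linarith
      refine hv0 (funext fun i => ?_)
      have h1 := G.le_root_of_laplacian_mulVec_nonpos hT hr (v := v)
        (fun i => by rw [hLv, hroot, neg_zero]) i
      have h2 := G.le_root_of_laplacian_mulVec_nonpos hT hr (v := -v)
        (fun i => by rw [hLv', hroot]) i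
      simp only [Pi.neg_apply, Pi.zero_apply] at h2 ⊢
      linarith
    have hMc : (complexify M).det ≠ 0 := by
      have : ((M.det : ℝ) : ℂ) = (complexify M).det := Complex.ofRealHom.map_det M
      rw [← this]
      exact_mod_cast hM
    refine eq_zero_of_vecMul_eq_zero hMc ?_
    have hsplit : complexify M = complexify G.laplacian + vecMulVec 1 (Pi.single r 1) := by
      ext i j
      simp [M, complexify, Pi.single_apply, apply_ite]
    have h1 : p ⬝ᵥ (1 : Fin n → ℂ) = 0 := by simpa [dotProduct] using hsum
    rw [hsplit, vecMul_add, hp, vecMul_vecMulVec, h1]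
    simp
  · have hdet : (complexify G.laplacian - z • (1 : Matrix (Fin n) (Fin n) ℂ)).det ≠ 0 := by
      refine det_ne_zero_of_sum_row_lt_diag fun k => ?_
      set s : ℝ := ∑ j, G.weight k j with hs
      have hs0 : 0 ≤ s := Finset.sum_nonneg fun j _ => G.weight_nonneg k j
      have hoff : ∑ j ∈ Finset.univ.erase k,
          ‖(complexify G.laplacian - z • (1 : Matrix (Fin n) (Fin n) ℂ)) k j‖ = s := by
        rw [hs, ← Finset.add_sum_erase _ _ (Finset.mem_univ k), G.weight_self, zero_add]
        refine Finset.sum_congr rfl fun j hj => ?_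
        have hkj : k ≠ j := (Finset.ne_of_mem_erase hj).symm
        simp [complexify, laplacian, hkj, abs_of_nonneg (G.weight_nonneg k j)]
      have hdiag : (complexify G.laplacian - z • (1 : Matrix (Fin n) (Fin n) ℂ)) k k = s - z := by
        simp [complexify, laplacian, G.weight_self, hs]
      rw [hoff, hdiag]
      -- The disc of radius `s` about `s` meets the closed left half-plane only in zero.
      refine lt_of_pow_lt_pow_left₀ 2 (norm_nonneg _) ?_
      have hz' : 0 < Complex.normSq z := Complex.normSq_pos.2 hz0
      rw [Complex.sq_norm, Complex.normSq_apply]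
      rw [Complex.normSq_apply] at hz'
      simp only [Complex.sub_re, Complex.ofReal_re, Complex.sub_im, Complex.ofReal_im]
      nlinarith [mul_nonneg hs0 (neg_nonneg.2 hre)]
    refine eq_zero_of_vecMul_eq_zero hdet ?_
    rw [vecMul_sub, hp, vecMul_smul, vecMul_one, sub_self]

/-- The same graph with all weights multiplied by `α > 0`. -/
def scale (α : ℝ) (hα : 0 < α) : WeightedDigraph n where
  edges := G.edges
  weight := α • G.weight
  weight_nonneg i j := mul_nonneg hα.le (G.weight_nonneg i j)
  weight_pos_iff i j := by simpa [hα] using G.weight_pos_iff i j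
  weight_self i := by simp [G.weight_self i]

theorem exists_of_mem_disagreementSpectrum_scale {α : ℝ} (hα : 0 < α) {z : ℂ}
    (hz : z ∈ (G.scale α hα).disagreementSpectrum) :
    ∃ w ∈ G.disagreementSpectrum, z = α * w := by
  obtain ⟨p, hp0, hsum, hp⟩ := hz
  have hα' : (α : ℂ) ≠ 0 := by exact_mod_cast hα.ne'
  have hL : complexify (G.scale α hα).laplacian = (α : ℂ) • complexify G.laplacian := by
    ext i j
    by_cases hij : i = j <;>
      simp [complexify, laplacian, scale, hij, ← Finset.mul_sum, mul_sub]
  refine ⟨(α : ℂ)⁻¹ * z, ⟨p, hp0, hsum, ?_⟩, by field_simp⟩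
  rw [hL, vecMul_smul] at hp
  rw [mul_smul, ← hp, smul_smul, inv_mul_cancel₀ hα', one_smul]

/-! ### A spectral criterion for consensus -/

/-- The coefficient matrices of the linear functionals that vanish on consensus states. -/
def zeroColumnSums (n d : ℕ) : Submodule ℂ (Matrix (Fin n) (Fin d) ℂ) where
  carrier := {Φ | ∀ k, ∑ i, Φ i k = 0}
  add_mem' {Φ Ψ} hΦ hΨ k := by simp [Finset.sum_add_distrib, hΦ k, hΨ k]
  zero_mem' k := by simp
  smul_mem' c Φ hΦ k := by simp [← Finset.mul_sum, hΦ k]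

/-- The functional `x ↦ ∑ i, ∑ k, Φ i k * x i k` on states, as a function of `Φ`. -/
def statePairing {n d : ℕ} (x : Fin n → EuclideanSpace ℝ (Fin d)) :
    Matrix (Fin n) (Fin d) ℂ →ₗ[ℂ] ℂ where
  toFun Φ := ∑ i, ∑ k, Φ i k * (x i k : ℂ)
  map_add' Φ Ψ := by simp [add_mul, Finset.sum_add_distrib]
  map_smul' c Φ := by simp [mul_assoc, Finset.mul_sum]

variable {d : ℕ} (C : Matrix (Fin d) (Fin d) ℝ)

/-- The adjoint of the dynamics, acting on coefficient matrices of functionals. -/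
def adjointDynamics : End ℂ (Matrix (Fin n) (Fin d) ℂ) :=
  mulRightLinearMap (Fin n) ℂ (complexify C) *
    (1 - mulLeftLinearMap (Fin d) ℂ (complexify G.laplacian)ᵀ) - 1

theorem adjointDynamics_apply (Φ : Matrix (Fin n) (Fin d) ℂ) :
    G.adjointDynamics C Φ =
      (Φ - (complexify G.laplacian)ᵀ * Φ) * complexify C - Φ := by
  simp [adjointDynamics]

theorem sum_mul_eq_trace (Φ Y : Matrix (Fin n) (Fin d) ℂ) :
    ∑ i, ∑ k, Φ i k * Y i k = (Φᵀ * Y).trace := by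
  simp only [trace, diag_apply, Matrix.mul_apply, transpose_apply]
  exact Finset.sum_comm

/-- The right-hand side of the dynamics at node `i` is `C` applied to `x i - (L x) i`, minus `x i`,
where `L` is the Laplacian. -/
theorem modelOne_velocity_apply (x : Fin n → EuclideanSpace ℝ (Fin d)) (i : Fin n) (k : Fin d) :
    ((∑ j ∈ G.neighbors i, G.weight i j • toEuclideanLin C (x j - x i))
        + toEuclideanLin (C - 1) (x i) : EuclideanSpace ℝ (Fin d)) k =
      ∑ l, (x i l - ∑ j, G.laplacian i j * x j l) * C k l - x i k := by
  have hneighbors : ∑ j ∈ G.neighbors i, G.weight i j • toEuclideanLin C (x j - x i) =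
      ∑ j, G.weight i j • toEuclideanLin C (x j - x i) := by
    refine Finset.sum_subset (Finset.subset_univ _) fun j _ hj => ?_
    have hw : ¬ 0 < G.weight i j := by
      simpa [neighbors, G.weight_pos_iff] using hj
    rw [le_antisymm (not_lt.1 hw) (G.weight_nonneg i j), zero_smul]
  have hL (l : Fin d) : ∑ j, G.laplacian i j * x j l = -∑ j, G.weight i j * (x j - x i) l := by
    rw [← Finset.sum_neg_distrib]
    refine (G.laplacian_mulVec (fun j => x j l) i).trans (Finset.sum_congr rfl fun j _ => ?_)
    simp
    ring
  have hC (v : EuclideanSpace ℝ (Fin d)) : toEuclideanLin C v k = ∑ l, v l * C k l := by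
    simp [toLpLin_apply, mulVec, dotProduct, mul_comm]
  have hone : toEuclideanLin (C - 1) (x i) = toEuclideanLin C (x i) - x i := by
    ext l
    simp [toLpLin_apply]
  rw [hneighbors, hone, ← add_sub_assoc, PiLp.sub_apply]
  simp only [← map_smul, ← map_sum, ← map_add, hC, hL, sub_neg_eq_add]
  simp [add_comm]

variable {C} in
/-- Along a solution `Ẋ = (X - L X) Cᵀ - X`, the derivative of `trace (Φᵀ X)` is the trace of
`(F Φ)ᵀ X`, by cyclicity of the trace. -/
theorem hasDerivWithinAt_statePairing {x : ℝ → Fin n → EuclideanSpace ℝ (Fin d)}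
    (hx : IsModelOneTrajectory G C x) (Φ : Matrix (Fin n) (Fin d) ℂ) {t : ℝ} (ht : 0 ≤ t) :
    HasDerivWithinAt (fun s => statePairing (x s) Φ)
      (statePairing (x t) (G.adjointDynamics C Φ)) (Set.Ici 0) t := by
  have hcoord (i : Fin n) (k : Fin d) := ((EuclideanSpace.proj (𝕜 := ℝ) k).hasFDerivAt
    |>.comp_hasDerivWithinAt t (hx t ht i)).ofReal_comp
  have hsum := HasDerivWithinAt.fun_sum fun i (_ : i ∈ Finset.univ) =>
    HasDerivWithinAt.fun_sum fun k (_ : k ∈ Finset.univ) => (hcoord i k).const_mul (Φ i k)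
  refine hsum.congr_deriv ?_
  let X : Matrix (Fin n) (Fin d) ℂ := Matrix.of fun i k => (x t i k : ℂ)
  have hvel (i : Fin n) (k : Fin d) :
      (((∑ j ∈ G.neighbors i, G.weight i j • toEuclideanLin C (x t j - x t i))
        + toEuclideanLin (C - 1) (x t i) : EuclideanSpace ℝ (Fin d)) k : ℂ) =
      ((X - complexify G.laplacian * X) * (complexify C)ᵀ - X) i k := by
    rw [G.modelOne_velocity_apply]
    simp [X, Matrix.mul_apply, complexify]
  calc _ = ∑ i, ∑ k, Φ i k * ((X - complexify G.laplacian * X) * (complexify C)ᵀ - X) i k :=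
        Finset.sum_congr rfl fun i _ => Finset.sum_congr rfl fun k _ => by rw [← hvel i k]; rfl
    _ = (Φᵀ * ((X - complexify G.laplacian * X) * (complexify C)ᵀ - X)).trace :=
        sum_mul_eq_trace _ _
    _ = statePairing (x t) (G.adjointDynamics C Φ) := by
        rw [show ∀ Ψ, statePairing (x t) Ψ = (Ψᵀ * X).trace from fun Ψ => sum_mul_eq_trace Ψ X,
          adjointDynamics_apply, Matrix.mul_sub, trace_sub,
          ← Matrix.mul_assoc, trace_mul_comm, transpose_sub, Matrix.sub_mul, trace_sub,
          transpose_mul, transpose_sub, transpose_mul, transpose_transpose]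
        simp only [X, Matrix.mul_sub, Matrix.sub_mul, Matrix.mul_assoc]

/-- All solutions reach consensus when `(1 - z) * μ - 1` has negative real part for every
eigenvalue `z` of the Laplacian on disagreements and every eigenvalue `μ` of `C`. -/
theorem achievesConsensus_of_re_lt_one
    (h : ∀ z ∈ G.disagreementSpectrum, ∀ μ : ℂ, HasEigenvalue (toLin' (complexify C)) μ →
      ((1 - z) * μ).re < 1) : AchievesConsensus G C := by
  intro x hx
  let W := zeroColumnSums n d
  let A : End ℂ (Matrix (Fin n) (Fin d) ℂ) :=
    mulLeftLinearMap (Fin d) ℂ (complexify G.laplacian)ᵀ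
  let B : End ℂ (Matrix (Fin n) (Fin d) ℂ) := mulRightLinearMap (Fin n) ℂ (complexify C)
  let F := G.adjointDynamics C
  have hF : F = B * (1 - A) - 1 := rfl
  have hA : ∀ Φ ∈ W, A Φ ∈ W := by
    intro Φ _ k
    have hrow (j : Fin n) : ∑ i, complexify G.laplacian j i = 0 := by
      simp only [complexify, map_apply]
      exact_mod_cast G.sum_laplacian_row j
    simp only [A, mulLeftLinearMap_apply, Matrix.mul_apply, transpose_apply]
    rw [Finset.sum_comm]
    simp [← Finset.sum_mul, hrow]
  have hB : ∀ Φ ∈ W, B Φ ∈ W := by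
    intro Φ hΦ k
    simp only [B, mulRightLinearMap_apply, Matrix.mul_apply]
    rw [Finset.sum_comm]
    simp [← Finset.sum_mul, hΦ _]
  have hAB : Commute A B := LinearMap.ext fun Φ => by simp [A, B, Matrix.mul_assoc]
  have hAF : Commute A F := by
    rw [hF]
    exact (hAB.mul_right ((Commute.one_right A).sub_right (Commute.refl A))).sub_right
      (Commute.one_right A)
  have hBF : Commute B F := by
    rw [hF]
    exact ((Commute.refl B).mul_right ((Commute.one_right B).sub_right hAB.symm)).sub_right
      (Commute.one_right B)
  have hFW : ∀ Φ ∈ W, F Φ ∈ W := fun Φ hΦ =>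
    W.sub_mem (hB _ (W.sub_mem hΦ (hA Φ hΦ))) hΦ
  have hneg : ∀ ν : ℂ, ∀ Φ ∈ W, Φ ≠ 0 → F Φ = ν • Φ → ν.re < 0 := by
    intro ν Φ hΦ hΦ0 hν
    obtain ⟨Ψ, hΨ, hΨ0, hFΨ, ⟨z, hz⟩, μ, hμ⟩ :=
      exists_common_eigenvector W hA hB hAB hAF hBF ⟨Φ, hΦ, hΦ0, hν⟩
    have hval : ν = (1 - z) * μ - 1 := by
      refine smul_left_injective ℂ hΨ0 ?_
      simp only [← hFΨ, hF]
      simp [hz, hμ, sub_smul, mul_smul]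
    obtain ⟨i, k, hik⟩ : ∃ i k, Ψ i k ≠ 0 := by
      by_contra! hc
      exact hΨ0 (Matrix.ext hc)
    have hzmem : z ∈ G.disagreementSpectrum := by
      refine ⟨fun j => Ψ j k, fun h0 => hik (congrFun h0 i), hΨ k, funext fun j => ?_⟩
      have := congrFun (congrFun hz j) k
      simpa [A, Matrix.mul_apply, vecMul, dotProduct, mul_comm] using this
    have hμev : HasEigenvalue (toLin' (complexify C)) μ := by
      have hdet : (complexify C - μ • (1 : Matrix (Fin d) (Fin d) ℂ)).det = 0 := by
        rw [← exists_vecMul_eq_zero_iff]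
        refine ⟨Ψ i, fun h0 => hik (congrFun h0 k), ?_⟩
        rw [vecMul_sub, vecMul_smul, vecMul_one, sub_eq_zero]
        ext l
        simpa [B, Matrix.mul_apply, vecMul, dotProduct] using congrFun (congrFun hμ i) l
      obtain ⟨v, hv0, hv⟩ := exists_mulVec_eq_zero_iff.2 hdet
      rw [sub_mulVec, smul_mulVec, one_mulVec, sub_eq_zero] at hv
      exact hasEigenvalue_of_hasEigenvector (x := v)
        ⟨mem_eigenspace_iff.2 (by rw [toLin'_apply, hv]), hv0⟩
    have := h z hzmem μ hμev
    rw [hval, Complex.sub_re, Complex.one_re]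
    linarith
  intro i j
  have hcoord (k : Fin d) : Tendsto (fun t => (x t i - x t j) k) atTop (𝓝 0) := by
    -- The functional reading off the difference of the `k`-th coordinates at `i` and `j`.
    let Φ : Matrix (Fin n) (Fin d) ℂ := Matrix.single i k 1 - Matrix.single j k 1
    have hΦ : Φ ∈ W := by
      intro l
      simp [Φ, Matrix.single_apply, ite_and]
    have := tendsto_zero_of_eigenvalues_re_neg F W hFW hneg (fun t => statePairing (x t))
      (fun Φ t ht => G.hasDerivWithinAt_statePairing hx Φ ht) hΦ
    have hre := (Complex.continuous_re.tendsto 0).comp this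
    refine hre.congr fun t => ?_
    simp [Φ, statePairing, Matrix.single_apply, sub_mul, ite_and, Finset.sum_sub_distrib]
  have hvec : Tendsto (fun t => x t i - x t j) atTop (𝓝 0) := by
    have := (PiLp.continuous_toLp 2 fun _ : Fin d => ℝ).tendsto 0 |>.comp
      (tendsto_pi_nhds.2 hcoord)
    simpa [Function.comp_def] using this
  simpa using hvec.norm

end WeightedDigraph

/-! ### Weak coupling -/

/-- For `μ = 1` the term `-α * z` decides, for `μ ≠ 1` the value at `α = 0` does. -/
theorem eventually_re_one_sub_mul_lt_one {z μ : ℂ} (hz : 0 < z.re) (hμ : μ ≠ 1 → μ.re < 1) :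
    ∀ᶠ α : ℝ in 𝓝[>] 0, ((1 - α * z) * μ).re < 1 := by
  rcases eq_or_ne μ 1 with rfl | hne
  · filter_upwards [self_mem_nhdsWithin] with α hα
    have : 0 < α * z.re := mul_pos hα hz
    simpa using this
  · have hc : Continuous fun α : ℝ => ((1 - α * z) * μ).re := by fun_prop
    refine (hc.tendsto 0).eventually_lt_const ?_ |>.filter_mono nhdsWithin_le_nhds
    simpa using hμ hne

theorem mainTheorem3 {n d : ℕ} (C : Matrix (Fin d) (Fin d) ℝ) (G : WeightedDigraph n)
    (hC : IsLogicMatrix C) (hG : G.HasDirectedSpanningTree) :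
    ∃ α₀ : ℝ, 0 < α₀ ∧ ∀ α : ℝ, 0 < α → α < α₀ →
      ∃ G' : WeightedDigraph n, G'.weight = α • G.weight ∧ G'.edges = G.edges ∧
        AchievesConsensus G' C := by
  -- Uniformity in `z` and `μ` comes from the finiteness of both spectra.
  have hev : ∀ᶠ α : ℝ in 𝓝[>] 0, ∀ z ∈ G.disagreementSpectrum,
      ∀ μ ∈ {μ | HasEigenvalue (toLin' (complexify C)) μ}, ((1 - α * z) * μ).re < 1 := by
    rw [eventually_all_finite G.finite_disagreementSpectrum]
    intro z hz
    rw [eventually_all_finite (finite_hasEigenvalue _)]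
    exact fun μ hμ => eventually_re_one_sub_mul_lt_one
      (G.re_pos_of_mem_disagreementSpectrum hG hz) (hC.re_lt_one μ hμ)
  obtain ⟨α₀, hα₀, hsub⟩ := mem_nhdsGT_iff_exists_Ioo_subset.1 hev
  refine ⟨α₀, hα₀, fun α hα hlt => ⟨G.scale α hα, rfl, rfl, ?_⟩⟩
  refine (G.scale α hα).achievesConsensus_of_re_lt_one C fun z hz μ hμ => ?_
  obtain ⟨w, hw, rfl⟩ := G.exists_of_mem_disagreementSpectrum_scale hα hz
  exact hsub ⟨hα, hlt⟩ w hw μ hμ
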